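/- Let $\mathbb F$ be the Fibonacci sequence, i.e. the fixed point beginning with $a$ of the morphism $\sigma(a)=ab$, $\sigma(b)=a$, with letters numbered from $1$, and let $\mathbb F[1,n]$ be its prefix of length $n$. For a factor $\omega$ of $\mathbb F$ let $\omega_p$ ($p\ge1$) be its $p$-th occurrence in $\mathbb F$. Let $\mathcal P_F$ be the set of nonempty palindromes occurring in $\mathbb F$, and put $$A(n)=\#\{(\omega,p):\omega\in\mathcal P_F,\ \omega_p\text{ lies in }\mathbb F[1,n]\},\qquad a(n)=\#\{(\omega,p):\omega\in\mathcal P_F,\ \omega_p\text{ ends at position }n\},$$ with $A(n)=a(n)=0$ for $n\le0$. Let $f_{-2}=0$, $f_{-1}=1$, $f_m=f_{m-1}+f_{m-2}$ for $m\ge0$ (and $f_m=0$ for $m<-2$), and let $C(m)=A(f_{m+1}-2)-A(f_m-2)$. For every integer $n\ge1$ there is exactly one integer $m$ with $f_m\le n+1<f_{m+1}$, and for this $m$ $$\sum_{i=f_m-1}^{n}a(i)=\begin{cases}\displaystyle\sum_{i=f_{m-2}-1}^{n-f_{m-1}}a(i)+n-f_m+2,& n+1<2f_{m-1},\\[2mm]\displaystyle\sum_{i=f_{m-1}-1}^{n-f_{m-1}}a(i)+C(m-2)+n-f_m+2,&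 n+1\ge 2f_{m-1}.\end{cases}$$ Moreover, $$A(n)=A(f_m-2)+\sum_{i=f_m-1}^{n}a(i),\qquad A(f_m-2)=\tfrac{m-3}{5}f_{m+2}+\tfrac{m-1}{5}f_m+2,\qquad C(m-2)=\tfrac{m-1}{5}f_{m-1}+\tfrac{m-4}{5}f_{m-3}.$$ Consequently the following algorithm computes $A(n)$: find $m$; evaluate $A(f_m-2)$ by its explicit expression; evaluate $\sum_{i=f_m-1}^{n}a(i)$ by applying the recursion above repeatedly, with the explicit expression for $C$, until $m\in\{0,1\}$, where the sum is $0$ or $1$ respectively. The recursion is applied at most $m$ times, and at most $2\lfloor\log_2(n+1)\rfloor$ times. -/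

import Mathlib

/-- The alphabet `{a, b}`. -/
inductive FibLetter
  | a
  | b
  deriving DecidableEq

namespace FibPal

/-- Images of the letters under the morphism `σ(a, b) = (ab, a)`. -/
def sigmaLetter : FibLetter → List FibLetter
  | .a => [.a, .b]
  | .b => [.a]

/-- The morphism `σ` on finite words. -/
def sigma (w : List FibLetter) : List FibLetter := w.flatMap sigmaLetter

/-- The finite words `F_m = σ^m(a)`, `m ≥ 0`. -/
def finWord (m : ℕ) : List FibLetter := sigma^[m] [.a]

/-- The `i`-th letter (`i ≥ 1`) of the Fibonacci sequence, the fixed point of `σ` beginning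
with `a`. It is read off the word `σ^i(a)`, which is a prefix of the fixed point, of length
larger than `i`; see `sigma_factor` below. -/
def letter (i : ℕ) : FibLetter := (finWord i).getD (i - 1) .a

/-- The word `𝔽[i, j]`: the letters of the Fibonacci sequence at the positions `i, …, j`
(the empty word if `j < i`). -/
def factor (i j : ℕ) : List FibLetter := (List.range (j + 1 - i)).map fun k => letter (i + k)

theorem finWord_succ (m : ℕ) : finWord (m + 1) = sigma (finWord m) :=
  Function.iterate_succ_apply' sigma m [.a]

theorem sigma_prefix {u v : List FibLetter} (h : u <+: v) : sigma u <+: sigma v := by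
  obtain ⟨t, rfl⟩ := h
  exact ⟨sigma t, by simp [sigma]⟩

theorem finWord_prefix_succ (m : ℕ) : finWord m <+: finWord (m + 1) := by
  induction m with
  | zero => exact ⟨[.b], rfl⟩
  | succ m ih =>
    rw [finWord_succ (m + 1)]
    conv_lhs => rw [finWord_succ m]
    exact sigma_prefix ih

theorem finWord_prefix {m k : ℕ} (h : m ≤ k) : finWord m <+: finWord k := by
  induction h with
  | refl => exact List.prefix_rfl
  | step _ ih => exact ih.trans (finWord_prefix_succ _)

theorem length_sigma (w : List FibLetter) : w.length ≤ (sigma w).length := by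
  induction w with
  | nil => simp
  | cons x w ih =>
    have : sigma (x :: w) = sigmaLetter x ++ sigma w := by simp [sigma]
    rw [this]
    cases x <;> simp [sigmaLetter] <;> omega

theorem length_finWord (m : ℕ) : m + 1 ≤ (finWord m).length := by
  induction m with
  | zero => simp [finWord]
  | succ m ih =>
    obtain ⟨t, ht⟩ : [FibLetter.a] <+: finWord m := finWord_prefix (Nat.zero_le m)
    have h1 : sigma (finWord m) = [.a, .b] ++ sigma t := by
      rw [← ht]; simp [sigma, sigmaLetter]
    have h2 := length_sigma t
    have h3 : (finWord m).length = t.length + 1 := by rw [← ht]; simp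
    rw [finWord_succ, h1]
    simp only [List.length_append, List.length_cons, List.length_nil]
    omega

theorem factor_one_eq_take {n k : ℕ} (h : n ≤ k) : factor 1 n = (finWord k).take n := by
  have hk := length_finWord k
  apply List.ext_getElem
  · simp [factor]; omega
  · intro i h1 h2
    have hi : i < n := by simpa [factor] using h1
    have hl := length_finWord (1 + i)
    have hp : finWord (1 + i) <+: finWord k := finWord_prefix (by omega)
    simp only [factor, letter, List.getElem_map, List.getElem_range, List.getElem_take]
    rw [List.getD_eq_getElem _ _ (by omega), hp.getElem (by omega)]
    simp

/-- The Fibonacci sequence begins with `a`. -/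
theorem letter_one : letter 1 = .a := rfl

/-- The Fibonacci sequence is fixed by `σ`: the image of each prefix is a prefix. -/
theorem sigma_factor (n : ℕ) : sigma (factor 1 n) = factor 1 (sigma (factor 1 n)).length := by
  set L := (sigma (factor 1 n)).length with hL
  rw [factor_one_eq_take (n := L) (k := max (n + 1) L) (le_max_right _ _)]
  have h1 : sigma (factor 1 n) <+: finWord (n + 1) := by
    rw [finWord_succ, factor_one_eq_take le_rfl]
    exact sigma_prefix (List.take_prefix _ _)
  exact List.prefix_iff_eq_take.1 (h1.trans (finWord_prefix (le_max_left _ _)))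

/-- The word `ω` occurs in the Fibonacci sequence with its first letter at position `L ≥ 1`. -/
def OccursAt (ω : List FibLetter) (L : ℕ) : Prop :=
  1 ≤ L ∧ factor L (L + ω.length - 1) = ω

/-- The `p`-th occurrence `ω_p` of `ω` (counted from `p = 1`) has its first letter at
position `L`, that is `L(ω, p) = L`. -/
def IsOccurrence (ω : List FibLetter) (p L : ℕ) : Prop :=
  OccursAt ω L ∧ {L' | L' ≤ L ∧ OccursAt ω L'}.ncard = p

/-- The nonempty palindromes occurring in the Fibonacci sequence. -/
def palindromes : Set (List FibLetter) :=
  {ω | ω ≠ [] ∧ ω.Palindrome ∧ ∃ L, OccursAt ω L}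

/-- `a(n)`: the number of pairs `(ω, p)`, `ω` a palindrome, such that `ω_p` ends at position
`n`. It is `0` for `n ≤ 0`. -/
noncomputable def a (n : ℤ) : ℤ :=
  ({x : List FibLetter × ℕ | x.1 ∈ palindromes ∧
    ∃ L, IsOccurrence x.1 x.2 L ∧ (L : ℤ) + x.1.length - 1 = n}.ncard : ℤ)

/-- `A(n)`: the number of pairs `(ω, p)`, `ω` a palindrome, such that `ω_p` lies inside
`𝔽[1, n]`. It is `0` for `n ≤ 0`. -/
noncomputable def A (n : ℤ) : ℤ :=
  ({x : List FibLetter × ℕ | x.1 ∈ palindromes ∧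
    ∃ L, IsOccurrence x.1 x.2 L ∧ (L : ℤ) + x.1.length - 1 ≤ n}.ncard : ℤ)

/-- The Fibonacci numbers with `f_{-2} = 0`, `f_{-1} = 1` and `f_m = f_{m-1} + f_{m-2}` for
`m ≥ 0`. Indices below `-2` are not used; the value there is `0`. -/
def f (m : ℤ) : ℤ := (Nat.fib (m + 2).toNat : ℤ)

/-- `C(m) = A(f_{m+1} - 2) - A(f_m - 2)`. -/
noncomputable def C (m : ℤ) : ℤ := A (f (m + 1) - 2) - A (f m - 2)

/-- The explicit expression `(m+1)/5 f_{m+1} + (m-2)/5 f_{m-1}` used by the algorithm in place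
of `C(m)`. The numerator is divisible by `5`. -/
def explicitC (m : ℤ) : ℤ := ((m + 1) * f (m + 1) + (m - 2) * f (m - 1)) / 5

/-- The explicit expression `(m-3)/5 f_{m+2} + (m-1)/5 f_m + 2` used by the algorithm in place
of `A(f_m - 2)`. The numerator is divisible by `5`. -/
def explicitA (m : ℤ) : ℤ := ((m - 3) * f (m + 2) + (m - 1) * f m) / 5 + 2

/-- The recursive procedure for `∑_{i = f_m - 1}^{n} a(i)`, where `f_m ≤ n + 1 < f_{m+1}`.
The first component is the value, the second one the number of recursive calls. -/
def recSum : ℕ → ℤ → ℤ × ℕ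
  | 0, _ => (0, 0)
  | 1, _ => (1, 0)
  | m + 2, n =>
    if n + 1 < 2 * f (m + 1) then
      let r := recSum m (n - f (m + 1))
      (r.1 + n - f (m + 2) + 2, r.2 + 1)
    else
      let r := recSum (m + 1) (n - f (m + 1))
      (r.1 + explicitC m + n - f (m + 2) + 2, r.2 + 1)

theorem exists_lt_f (n : ℕ) : ∃ k : ℕ, (n : ℤ) + 1 < f (k + 1) := by
  refine ⟨n + 4, ?_⟩
  have h := Nat.le_fib_self (n := n + 7) (by omega)
  have h2 : (((n + 4 : ℕ) : ℤ) + 1 + 2).toNat = n + 7 := by omega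
  rw [f, h2]
  omega

/-- The first index `m = 0, 1, 2, …` with `n + 1 < f_{m+1}`. -/
def findIndex (n : ℕ) : ℕ := Nat.find (exists_lt_f n)

/-- The algorithm for `A(n)`: find the index `m`, then add the explicit value of `A(f_m - 2)`
and the recursively computed sum. The second component is the number of recursive calls. -/
def algorithmA (n : ℕ) : ℤ × ℕ :=
  let r := recSum (findIndex n) n
  (explicitA (findIndex n) + r.1, r.2)

end FibPal

namespace FibPal

/-! ### The letters of the Fibonacci sequence -/

/-! An occurrence ending at `i` is determined by its start, so `a i` counts the palindromic suffixes
of the prefix of length `i` (`a_natCast`). Let `f_m - 1 ≤ i ≤ f_{m+1} - 2`. The prefix of length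
`f_{m+1} - 2` has period `f_{m-1}`, so the suffixes starting beyond position `f_{m-1}` match those
of the prefix of length `i - f_{m-1}`. Exactly one further palindromic suffix starts in the first
`f_{m-1}` letters: existence combines the period with the palindromicity of that prefix, uniqueness
is Fine–Wilf. Hence `a i = a (i - f_{m-1}) + 1` (`card_suffixStarts_add_fib`).

Summing gives `A_sub_A_eq`, of which both cases of the recursion are rearrangements; at `n = f_{m+1}
- 2` it is a linear recurrence for `A (f_m - 2)`, which yields the closed forms. The bounds on the
number of calls come from the descent of `m` and the growth of `f`. -/

theorem finWord_add_two (m : ℕ) : finWord (m + 2) = finWord (m + 1) ++ finWord m := by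
  induction m with
  | zero => rfl
  | succ m ih =>
    rw [finWord_succ (m + 2), ih]
    simp only [sigma, List.flatMap_append]
    rw [← sigma, ← sigma, ← finWord_succ, ← finWord_succ, ih]

theorem length_finWord_eq_fib (m : ℕ) : (finWord m).length = Nat.fib (m + 2) := by
  induction m using Nat.twoStepInduction with
  | zero => rfl
  | one => rfl
  | more m h1 h2 =>
    rw [finWord_add_two, List.length_append, h1, h2, Nat.fib_add_two (n := m + 2), add_comm]

theorem letter_eq_getElem? {m x : ℕ} (hx : 1 ≤ x) (hm : x ≤ Nat.fib (m + 2)) :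
    (finWord m)[x - 1]? = some (letter x) := by
  have h1 := length_finWord x
  have h2 := length_finWord_eq_fib m
  rw [letter, List.getD_eq_getElem _ _ (by omega), List.getElem?_eq_getElem (by omega)]
  rcases le_total m x with h | h
  · rw [(finWord_prefix h).getElem (by omega)]
  · rw [(finWord_prefix h).getElem (by omega)]

theorem letter_fib_add {k x : ℕ} (hx : 1 ≤ x) (hk : x ≤ Nat.fib (k + 2)) :
    letter (Nat.fib (k + 3) + x) = letter x := by
  have h2 : (finWord (k + 1)).length = Nat.fib (k + 3) := length_finWord_eq_fib (k + 1)
  have h3 : Nat.fib (k + 4) = Nat.fib (k + 2) + Nat.fib (k + 3) := Nat.fib_add_two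
  have h4 := letter_eq_getElem? (m := k + 2) (x := Nat.fib (k + 3) + x) (by omega)
    (by rw [h3]; omega)
  rw [finWord_add_two, List.getElem?_append_right (by rw [h2]; omega), h2,
    show Nat.fib (k + 3) + x - 1 - Nat.fib (k + 3) = x - 1 by omega,
    letter_eq_getElem? hx hk] at h4
  exact (Option.some.inj h4).symm

/-- The prefix of length `f_{k+2} - 2` has the period `f_k`. -/
theorem letter_add_fib {k x : ℕ} (hx : 1 ≤ x) (hk : x + 2 ≤ Nat.fib (k + 3)) :
    letter (x + Nat.fib (k + 2)) = letter x := by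
  induction k generalizing x with
  | zero =>
    simp [Nat.fib] at hk
    omega
  | succ k ih =>
    have h3 : Nat.fib (k + 4) = Nat.fib (k + 2) + Nat.fib (k + 3) := Nat.fib_add_two
    have hk' : x + 2 ≤ Nat.fib (k + 4) := hk
    change letter (x + Nat.fib (k + 3)) = _
    rcases le_or_gt x (Nat.fib (k + 2)) with h | h
    · rw [add_comm, letter_fib_add hx h]
    -- Both positions are copies of `y + 1`: one shifted by `f_k`, the other by `f_{k+2}`.
    · obtain ⟨y, rfl⟩ := Nat.exists_eq_add_of_lt h
      rw [show Nat.fib (k + 2) + y + 1 + Nat.fib (k + 3) = Nat.fib (k + 4) + (y + 1) by omega,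
        letter_fib_add (k := k + 1) (by omega) (by change _ ≤ Nat.fib (k + 3); omega),
        ← ih (by omega) (by omega)]
      congr 1
      omega

/-- The prefix of length `f_k - 2` is a palindrome. -/
theorem letter_eq_letter_of_add_eq {k x y : ℕ} (hx : 1 ≤ x) (hy : 1 ≤ y)
    (h : x + y + 1 = Nat.fib (k + 2)) : letter x = letter y := by
  induction k using Nat.twoStepInduction generalizing x y with
  | zero => simp at h; omega
  | one => simp [Nat.fib] at h; omega
  | more k _ ih =>
    have h4 : Nat.fib (k + 4) = Nat.fib (k + 2) + Nat.fib (k + 3) := Nat.fib_add_two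
    have h3 : Nat.fib (k + 3) = Nat.fib (k + 1) + Nat.fib (k + 2) := Nat.fib_add_two
    change _ = Nat.fib (k + 4) at h
    -- Subtracting the period `f_k` from `v` reduces the sum to `f_{k+1} - 1`.
    have key : ∀ u v : ℕ, 1 ≤ u → 1 ≤ v → u + v + 1 = Nat.fib (k + 4) → Nat.fib (k + 2) < v →
        letter u = letter v := by
      intro u v hu hv huv hlt
      obtain ⟨w, rfl⟩ := Nat.exists_eq_add_of_lt hlt
      rw [show Nat.fib (k + 2) + w + 1 = w + 1 + Nat.fib (k + 2) by omega,
        letter_add_fib (by omega) (by omega)]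
      exact ih hu (by omega) (by change _ = Nat.fib (k + 3); omega)
    rcases lt_or_ge (Nat.fib (k + 2)) y with hlt | hge
    · exact key x y hx hy h hlt
    rcases lt_or_ge (Nat.fib (k + 2)) x with hlt' | hge'
    · exact (key y x hy hx (by omega) hlt').symm
    -- If neither position exceeds `f_k`, the sum `2 f_k + f_{k-1} - 1` forces `x = y = f_k`.
    have h1 : Nat.fib (k + 1) ≤ 1 := by omega
    have h2 : Nat.fib (k + 2) = Nat.fib k + Nat.fib (k + 1) := Nat.fib_add_two
    have h0 := Nat.fib_pos (n := k + 1)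
    have : x = y := by omega
    rw [this]

/-- Since `F_{m+2} = F_{m+1} F_m`, penultimate letters repeat with step two. The period `f_k` of
`letter_add_fib` therefore breaks exactly at position `f_{k+2} - 1`. -/
theorem letter_fib_sub_one_ne (k : ℕ) :
    letter (Nat.fib (k + 4) - 1) ≠ letter (Nat.fib (k + 3) - 1) := by
  induction k with
  | zero => decide
  | succ k ih =>
    have h5 : Nat.fib (k + 5) = Nat.fib (k + 3) + Nat.fib (k + 4) := Nat.fib_add_two
    have h3 : 2 ≤ Nat.fib (k + 3) := Nat.fib_mono (show 3 ≤ k + 3 by omega)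
    change letter (Nat.fib (k + 5) - 1) ≠ letter (Nat.fib (k + 4) - 1)
    rw [show Nat.fib (k + 5) - 1 = Nat.fib (k + 4) + (Nat.fib (k + 3) - 1) by omega,
      letter_fib_add (k := k + 1) (by omega) (by change _ ≤ Nat.fib (k + 3); omega)]
    exact ih.symm

/-! ### Factors, periods and palindromes -/

theorem length_factor (i j : ℕ) : (factor i j).length = j + 1 - i := by
  simp [factor]

theorem getElem?_factor {i j k : ℕ} (h : k < j + 1 - i) :
    (factor i j)[k]? = some (letter (i + k)) := by
  simp [factor, h]

theorem palindrome_factor_iff (i j : ℕ) :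
    (factor i j).Palindrome ↔ ∀ x y, i ≤ x → i ≤ y → x + y = i + j → letter x = letter y := by
  rw [List.Palindrome.iff_reverse_eq, List.ext_getElem?_iff]
  constructor
  · intro h x y hx hy hxy
    have h1 := h (x - i)
    rw [List.getElem?_reverse (by rw [length_factor]; omega), length_factor,
      getElem?_factor (by omega), getElem?_factor (by omega)] at h1
    have h2 := Option.some.inj h1
    rw [show i + (j + 1 - i - 1 - (x - i)) = y by omega, show i + (x - i) = x by omega] at h2
    exact h2.symm
  · intro h k
    rcases lt_or_ge k (j + 1 - i) with hk | hk
    · rw [List.getElem?_reverse (by rw [length_factor]; omega), length_factor,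
        getElem?_factor (by omega), getElem?_factor (by omega)]
      exact congrArg some (h _ _ (by omega) (by omega) (by omega))
    · rw [List.getElem?_eq_none (by rw [List.length_reverse, length_factor]; omega),
        List.getElem?_eq_none (by rw [length_factor]; omega)]

theorem hasPeriod_factor {i j p : ℕ} (h : ∀ x, i ≤ x → x + p ≤ j → letter (x + p) = letter x) :
    (factor i j).HasPeriod p := by
  rw [List.hasPeriod_iff_getElem?]
  intro k hk
  rw [length_factor] at hk
  rw [getElem?_factor (by omega), getElem?_factor (by omega), ← add_assoc,
    h _ (by omega) (by omega)]

theorem letter_eq_of_hasPeriod {i j p x y : ℕ} (h : (factor i j).HasPeriod p) (hx : i ≤ x)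
    (hxj : x ≤ j) (hy : i ≤ y) (hyj : y ≤ j) (hxy : x ≡ y [MOD p]) : letter x = letter y := by
  rw [List.hasPeriod_iff_forall_getElem?_mod] at h
  have h1 := h (x - i) (by rw [length_factor]; omega)
  have h2 := h (y - i) (by rw [length_factor]; omega)
  have h3 : x - i ≡ y - i [MOD p] := by
    apply Nat.ModEq.add_right_cancel' i
    rwa [Nat.sub_add_cancel hx, Nat.sub_add_cancel hy]
  rw [h3, ← h2, getElem?_factor (by omega), getElem?_factor (by omega)] at h1
  have h4 := Option.some.inj h1
  rwa [show i + (x - i) = x by omega, show i + (y - i) = y by omega] at h4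

/-- Every prefix of length less than `f_{k+2} - 1` has a palindromic suffix beginning in its first
`f_k` letters. -/
theorem exists_palindrome_factor {k i : ℕ} (hi : i + 2 ≤ Nat.fib (k + 4)) :
    ∃ t, 1 ≤ t ∧ t ≤ Nat.fib (k + 2) ∧ (factor t i).Palindrome := by
  have hP : 0 < Nat.fib (k + 2) := Nat.fib_pos.2 (by omega)
  have h4 : Nat.fib (k + 4) = Nat.fib (k + 2) + Nat.fib (k + 3) := Nat.fib_add_two
  set P := Nat.fib (k + 2) with hPdef
  set N := Nat.fib (k + 4) with hN
  have hper : (factor 1 (N - 2)).HasPeriod P :=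
    hasPeriod_factor fun x hx hxN => letter_add_fib hx (by omega)
  -- Reflecting the long prefix sends `x` to `N - 1 - x`. By periodicity `x ↦ t + i - x` works as
  -- well once `t ≡ N - 1 - i` mod `P`; this is the representative in `[1, P]`.
  refine ⟨(N - 2 - i) % P + 1, by omega, Nat.mod_lt _ hP, ?_⟩
  rw [palindrome_factor_iff]
  intro x y hx hy hxy
  have h1 : letter x = letter (N - 1 - x) :=
    letter_eq_letter_of_add_eq (k := k + 2) (by omega) (by omega) (by rw [← hN]; omega)
  rw [h1]
  refine letter_eq_of_hasPeriod hper (by omega) (by omega) (by omega) (by omega) ?_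
  have h5 : (N - 2 - i) % P ≡ N - 2 - i [MOD P] := Nat.mod_modEq _ _
  apply Nat.ModEq.add_right_cancel' x
  rw [show N - 1 - x + x = N - 2 - i + (i + 1) by omega,
    show y + x = (N - 2 - i) % P + (i + 1) by omega]
  exact (h5.add_right _).symm

/-- Two palindromic suffixes differ by a translation, so `s - t` is a period from `t` to `i`.
Fine–Wilf merges it with a Fibonacci period, and the result carries that period across the position
where it must break. -/
theorem not_palindrome_factor_of_lt {k i t s : ℕ} (h1 : Nat.fib (k + 3) ≤ i + 1) (ht : 1 ≤ t)
    (hts : t < s) (hs : s ≤ Nat.fib (k + 2)) (hpt : (factor t i).Palindrome) :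
    ¬ (factor s i).Palindrome := by
  intro hps
  obtain _ | k := k
  · simp at hs; omega
  have h4 : Nat.fib (k + 4) = Nat.fib (k + 2) + Nat.fib (k + 3) := Nat.fib_add_two
  have h2 : 0 < Nat.fib (k + 2) := Nat.fib_pos.2 (by omega)
  change Nat.fib (k + 4) ≤ i + 1 at h1
  change s ≤ Nat.fib (k + 3) at hs
  rw [palindrome_factor_iff] at hpt hps
  obtain ⟨d, rfl⟩ := Nat.exists_eq_add_of_lt hts
  have hd : ∀ x, t ≤ x → x + (d + 1) ≤ i → letter (x + (d + 1)) = letter x := by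
    intro x hx hxi
    rw [hpt x (t + i - x) hx (by omega) (by omega)]
    exact hps _ _ (by omega) (by omega) (by omega)
  have hp1 : (factor t (Nat.fib (k + 4) - 2)).HasPeriod (d + 1) :=
    hasPeriod_factor fun x hx hxN => hd x hx (by omega)
  have hp2 : (factor t (Nat.fib (k + 4) - 2)).HasPeriod (Nat.fib (k + 2)) :=
    hasPeriod_factor fun x hx hxN => letter_add_fib (by omega) (by omega)
  have hg : 0 < (d + 1).gcd (Nat.fib (k + 2)) := Nat.gcd_pos_of_pos_left _ (by omega)
  -- The bound on `s` gives just the length Fine–Wilf needs, with `gcd ≥ 1` covering the last unit.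
  have hp := hp1.gcd hp2 (by rw [length_factor]; omega)
  apply letter_fib_sub_one_ne k
  rw [show Nat.fib (k + 4) - 1 = Nat.fib (k + 4) - 1 - (d + 1) + (d + 1) by omega,
    hd _ (by omega) (by omega)]
  refine letter_eq_of_hasPeriod hp (by omega) (by omega) (by omega) (by omega) ?_
  have e1 : Nat.fib (k + 4) - 1 - (d + 1) ≡ Nat.fib (k + 4) - 1 - (d + 1) + (d + 1)
      [MOD (d + 1).gcd (Nat.fib (k + 2))] := by
    simpa using (Nat.modEq_zero_iff_dvd.2 (Nat.gcd_dvd_left (d + 1) (Nat.fib (k + 2)))).symm.add_left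
      (Nat.fib (k + 4) - 1 - (d + 1))
  have e2 : Nat.fib (k + 3) - 1 ≡ Nat.fib (k + 3) - 1 + Nat.fib (k + 2)
      [MOD (d + 1).gcd (Nat.fib (k + 2))] := by
    simpa using (Nat.modEq_zero_iff_dvd.2 (Nat.gcd_dvd_right (d + 1) (Nat.fib (k + 2)))).symm.add_left
      (Nat.fib (k + 3) - 1)
  refine e1.trans ((Nat.ModEq.symm ?_))
  convert e2 using 1
  omega

/-! ### Counting palindromic suffixes -/

open Classical in
/-- The positions at which a palindromic suffix of the prefix of length `i` begins. -/
noncomputable def suffixStarts (i : ℕ) : Finset ℕ :=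
  {t ∈ Finset.Icc 1 i | (factor t i).Palindrome}

theorem mem_suffixStarts {i t : ℕ} :
    t ∈ suffixStarts i ↔ (1 ≤ t ∧ t ≤ i) ∧ (factor t i).Palindrome := by
  simp [suffixStarts]

theorem palindrome_factor_add_fib {k i t : ℕ} (hi : i + 2 ≤ Nat.fib (k + 3)) (ht : 1 ≤ t) :
    (factor (t + Nat.fib (k + 2)) (i + Nat.fib (k + 2))).Palindrome ↔
      (factor t i).Palindrome := by
  rw [palindrome_factor_iff, palindrome_factor_iff]
  constructor
  · intro h x y hx hy hxy
    rw [← letter_add_fib (k := k) (x := x) (by omega) (by omega),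
      ← letter_add_fib (k := k) (x := y) (by omega) (by omega)]
    exact h _ _ (by omega) (by omega) (by omega)
  · intro h x y hx hy hxy
    have := h (x - Nat.fib (k + 2)) (y - Nat.fib (k + 2)) (by omega) (by omega) (by omega)
    rw [← letter_add_fib (k := k) (x := x - Nat.fib (k + 2)) (by omega) (by omega),
      ← letter_add_fib (k := k) (x := y - Nat.fib (k + 2)) (by omega) (by omega)] at this
    rwa [Nat.sub_add_cancel (by omega), Nat.sub_add_cancel (by omega)] at this

theorem card_suffixStarts_add_fib {k i : ℕ} (h1 : Nat.fib (k + 1) ≤ i + 1)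
    (h2 : i + 2 ≤ Nat.fib (k + 3)) :
    (suffixStarts (i + Nat.fib (k + 2))).card = (suffixStarts i).card + 1 := by
  have h3 : Nat.fib (k + 3) = Nat.fib (k + 1) + Nat.fib (k + 2) := Nat.fib_add_two
  have h4 : Nat.fib (k + 4) = Nat.fib (k + 2) + Nat.fib (k + 3) := Nat.fib_add_two
  obtain ⟨s, hs1, hs2, hs⟩ :=
    exists_palindrome_factor (k := k) (i := i + Nat.fib (k + 2)) (by omega)
  have hset : suffixStarts (i + Nat.fib (k + 2)) =
      insert s ((suffixStarts i).map (addRightEmbedding (Nat.fib (k + 2)))) := by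
    ext t
    simp only [Finset.mem_insert, Finset.mem_map, mem_suffixStarts, addRightEmbedding_apply]
    constructor
    · rintro ⟨⟨ht1, ht2⟩, ht⟩
      rcases le_or_gt t (Nat.fib (k + 2)) with hle | hlt
      · left
        rcases lt_trichotomy t s with h | h | h
        · exact absurd hs (not_palindrome_factor_of_lt (k := k) (by omega) ht1 h hs2 ht)
        · exact h
        · exact absurd ht (not_palindrome_factor_of_lt (k := k) (by omega) hs1 h hle hs)
      · right
        refine ⟨t - Nat.fib (k + 2), ⟨⟨by omega, by omega⟩, ?_⟩, by omega⟩
        rw [← palindrome_factor_add_fib h2 (by omega), Nat.sub_add_cancel hlt.le]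
        exact ht
    · rintro (rfl | ⟨u, ⟨⟨hu1, hu2⟩, hu⟩, rfl⟩)
      · exact ⟨⟨hs1, by omega⟩, hs⟩
      · exact ⟨⟨by omega, by omega⟩, (palindrome_factor_add_fib h2 hu1).2 hu⟩
  rw [hset, Finset.card_insert_of_notMem, Finset.card_map]
  simp only [Finset.mem_map, mem_suffixStarts, addRightEmbedding_apply]
  rintro ⟨u, ⟨⟨hu, _⟩, _⟩, rfl⟩
  omega

/-! ### The counting functions `a` and `A` -/

theorem IsOccurrence.unique {ω : List FibLetter} {p L L' : ℕ} (h : IsOccurrence ω p L)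
    (h' : IsOccurrence ω p L') : L = L' := by
  have key : ∀ {u v : ℕ}, IsOccurrence ω p u → IsOccurrence ω p v → ¬ u < v := by
    intro u v hu hv huv
    have hlt : {x | x ≤ u ∧ OccursAt ω x} ⊂ {x | x ≤ v ∧ OccursAt ω x} := by
      refine ⟨fun x hx => ⟨hx.1.trans huv.le, hx.2⟩, fun hsub => ?_⟩
      exact absurd (hsub ⟨le_rfl, hv.1⟩).1 (not_le.2 huv)
    have := Set.ncard_lt_ncard hlt ((Set.finite_Iic v).subset fun x hx => hx.1)
    rw [hu.2, hv.2] at this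
    exact lt_irrefl _ this
  exact le_antisymm (not_lt.1 (key h' h)) (not_lt.1 (key h h'))

/-- The pairs `(ω, p)` counted by `a n`. -/
def endingAt (n : ℤ) : Set (List FibLetter × ℕ) :=
  {x | x.1 ∈ palindromes ∧ ∃ L, IsOccurrence x.1 x.2 L ∧ (L : ℤ) + x.1.length - 1 = n}

/-- The pairs `(ω, p)` counted by `A n`. -/
def endingUpTo (n : ℤ) : Set (List FibLetter × ℕ) :=
  {x | x.1 ∈ palindromes ∧ ∃ L, IsOccurrence x.1 x.2 L ∧ (L : ℤ) + x.1.length - 1 ≤ n}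

theorem endingUpTo_of_nonpos {n : ℤ} (hn : n ≤ 0) : endingUpTo n = ∅ := by
  refine Set.eq_empty_of_forall_notMem ?_
  rintro x ⟨hx, L, hL, hLn⟩
  have h1 := List.length_pos_iff.2 hx.1
  have h2 := hL.1.1
  omega

theorem endingAt_subset_endingUpTo (n : ℤ) : endingAt n ⊆ endingUpTo n := by
  rintro x ⟨hx, L, hL, hLn⟩
  exact ⟨hx, L, hL, hLn.le⟩

/-- The start `t` fixes the word, and `p` is then forced as the number of its occurrences starting
at or before `t`. -/
theorem endingAt_natCast (i : ℕ) :
    endingAt i = (fun t => (factor t i, {L' | L' ≤ t ∧ OccursAt (factor t i) L'}.ncard)) ''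
      (suffixStarts i : Set ℕ) := by
  ext ⟨ω, p⟩
  simp only [Set.mem_image, Finset.mem_coe, mem_suffixStarts, Prod.mk.injEq]
  constructor
  · rintro ⟨hω, L, hL, hLn⟩
    have h1 := List.length_pos_iff.2 hω.1
    have h2 := hL.1.1
    have h3 : L + ω.length - 1 = i := by simp only at hLn h1; omega
    have h4 : factor L i = ω := by rw [← h3]; exact hL.1.2
    exact ⟨L, ⟨⟨h2, by simp only at h1; omega⟩, h4 ▸ hω.2.1⟩, h4, by rw [h4]; exact hL.2⟩
  · rintro ⟨t, ⟨⟨ht1, ht2⟩, ht⟩, rfl, rfl⟩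
    have hlen := length_factor t i
    have hocc : OccursAt (factor t i) t := by
      refine ⟨ht1, ?_⟩
      rw [hlen, show t + (i + 1 - t) - 1 = i by omega]
    refine ⟨⟨List.length_pos_iff.1 (by simp only; omega), ht, t, hocc⟩, t, ⟨hocc, rfl⟩, ?_⟩
    simp only
    omega

theorem a_natCast (i : ℕ) : a i = (suffixStarts i).card := by
  change ((endingAt i).ncard : ℤ) = _
  rw [endingAt_natCast, Set.InjOn.ncard_image, Set.ncard_coe_finset]
  intro t ht s hs hts
  rw [Finset.mem_coe, mem_suffixStarts] at ht hs
  have h := congrArg List.length (Prod.ext_iff.1 hts).1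
  simp only [length_factor] at h
  omega

theorem endingAt_finite (n : ℤ) : (endingAt n).Finite := by
  rcases le_total n 0 with hn | hn
  · exact Set.finite_empty.subset (endingUpTo_of_nonpos hn ▸ endingAt_subset_endingUpTo n)
  · lift n to ℕ using hn
    rw [endingAt_natCast]
    exact (Finset.finite_toSet _).image _

theorem endingUpTo_eq_union (n : ℤ) : endingUpTo n = endingUpTo (n - 1) ∪ endingAt n := by
  ext x
  constructor
  · rintro ⟨hx, L, hL, hLn⟩
    rcases hLn.eq_or_lt with h | h
    · exact Or.inr ⟨hx, L, hL, h⟩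
    · exact Or.inl ⟨hx, L, hL, by omega⟩
  · rintro (⟨hx, L, hL, hLn⟩ | h)
    · exact ⟨hx, L, hL, by omega⟩
    · exact endingAt_subset_endingUpTo n h

theorem endingUpTo_finite (n : ℤ) : (endingUpTo n).Finite := by
  rcases le_total n 0 with hn | hn
  · rw [endingUpTo_of_nonpos hn]
    exact Set.finite_empty
  · induction n, hn using Int.leInduction with
    | base =>
      rw [endingUpTo_of_nonpos le_rfl]
      exact Set.finite_empty
    | succ n hn ih =>
      rw [endingUpTo_eq_union, add_sub_cancel_right]
      exact ih.union (endingAt_finite _)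

theorem A_of_nonpos {n : ℤ} (hn : n ≤ 0) : A n = 0 := by
  change ((endingUpTo n).ncard : ℤ) = 0
  rw [endingUpTo_of_nonpos hn, Set.ncard_empty, Nat.cast_zero]

theorem A_eq_add (n : ℤ) : A n = A (n - 1) + a n := by
  change ((endingUpTo n).ncard : ℤ) = (endingUpTo (n - 1)).ncard + (endingAt n).ncard
  rw [endingUpTo_eq_union, Set.ncard_union_eq _ (endingUpTo_finite _) (endingAt_finite _),
    Nat.cast_add]
  rw [Set.disjoint_left]
  rintro x ⟨_, L, hL, hLn⟩ ⟨_, L', hL', hLn'⟩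
  have := hL.unique hL'
  omega

theorem sum_a_Icc {u n : ℤ} (h : u - 1 ≤ n) : ∑ i ∈ Finset.Icc u n, a i = A n - A (u - 1) := by
  induction n, h using Int.leInduction with
  | base => simp
  | succ n hn ih =>
    rw [← Finset.insert_Icc_right_eq_Icc_add_one (by omega), Finset.sum_insert (by simp), ih,
      A_eq_add (n + 1), add_sub_cancel_right]
    ring

/-! ### The numbers `f` -/

theorem f_natCast (k : ℕ) : f k = Nat.fib (k + 2) := rfl

theorem f_eq_add {m : ℤ} (hm : 0 ≤ m) : f m = f (m - 1) + f (m - 2) := by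
  obtain ⟨k, rfl⟩ := Int.eq_ofNat_of_zero_le hm
  have h1 : ((k : ℤ) - 1 + 2).toNat = k + 1 := by omega
  have h2 : ((k : ℤ) - 2 + 2).toNat = k := by omega
  rw [f_natCast, f, f, h1, h2, Nat.fib_add_two]
  push_cast
  ring

theorem f_zero : f 0 = 1 := rfl

theorem f_one : f 1 = 2 := rfl

theorem f_mono : Monotone f := fun m k h => by
  unfold f
  exact_mod_cast Nat.fib_mono (by omega)

/-! ### The recursion -/

theorem a_eq_a_sub_f_add_one {m i : ℤ} (hm : 1 ≤ m) (h1 : f m - 1 ≤ i) (h2 : i ≤ f (m + 1) - 2) :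
    a i = a (i - f (m - 1)) + 1 := by
  obtain ⟨k, rfl⟩ : ∃ k : ℕ, m = k + 1 := ⟨(m - 1).toNat, by omega⟩
  have e0 : f ((k : ℤ) + 1 - 1) = Nat.fib (k + 2) := by rw [add_sub_cancel_right]; rfl
  have e1 : f ((k : ℤ) + 1) = Nat.fib (k + 3) := rfl
  have e2 : f ((k : ℤ) + 1 + 1) = Nat.fib (k + 4) := rfl
  have h3 : Nat.fib (k + 3) = Nat.fib (k + 1) + Nat.fib (k + 2) := Nat.fib_add_two
  have h4 : Nat.fib (k + 4) = Nat.fib (k + 2) + Nat.fib (k + 3) := Nat.fib_add_two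
  have h5 := Nat.fib_pos.2 (show 0 < k + 1 by omega)
  rw [e0]
  rw [e1] at h1
  rw [e2] at h2
  obtain ⟨j, rfl⟩ : ∃ j : ℕ, i = ((j + Nat.fib (k + 2) : ℕ) : ℤ) :=
    ⟨(i - Nat.fib (k + 2)).toNat, by omega⟩
  rw [a_natCast, card_suffixStarts_add_fib (k := k) (by omega) (by omega),
    show ((j + Nat.fib (k + 2) : ℕ) : ℤ) - Nat.fib (k + 2) = (j : ℕ) by push_cast; ring, a_natCast]
  push_cast
  rfl

/-- The relation `a i = a (i - f_{m-1}) + 1` is summed over `n - f_m + 2` terms; the base case is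
the empty sum. -/
theorem A_sub_A_eq {m n : ℤ} (hm : 1 ≤ m) (h1 : f m - 2 ≤ n) (h2 : n ≤ f (m + 1) - 2) :
    A n - A (f m - 2) = A (n - f (m - 1)) - A (f (m - 2) - 2) + (n - f m + 2) := by
  have h3 := f_eq_add (m := m) (by omega)
  induction n, h1 using Int.leInduction with
  | base =>
    rw [show f m - 2 - f (m - 1) = f (m - 2) - 2 by omega]
    ring
  | succ n hn ih =>
    have h4 := a_eq_a_sub_f_add_one hm (i := n + 1) (by omega) h2
    have h5 := A_eq_add (n + 1)
    have h6 := A_eq_add (n + 1 - f (m - 1))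
    rw [show n + 1 - f (m - 1) - 1 = n - f (m - 1) by ring] at h6
    rw [add_sub_cancel_right] at h5
    have := ih (by omega)
    omega

/-- The factor 5 avoids division. The range starts at `-1` because `C (m - 2)` is needed at `m = 1`.
-/
theorem five_mul_A_f_sub_two {m : ℤ} (hm : -1 ≤ m) :
    5 * (A (f m - 2) - 2) = (m - 3) * f (m + 2) + (m - 1) * f m := by
  have key : ∀ k : ℕ, 5 * (A (f ((k : ℤ) - 1) - 2) - 2) =
      ((k : ℤ) - 1 - 3) * f ((k : ℤ) + 1) + ((k : ℤ) - 1 - 1) * f ((k : ℤ) - 1) := by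
    intro k
    induction k using Nat.strong_induction_on with
    | _ k ih =>
      match k with
      | 0 => rw [A_of_nonpos (by decide)]; rfl
      | 1 => rw [A_of_nonpos (by decide)]; rfl
      | 2 => rw [A_of_nonpos (by decide)]; rfl
      | j + 3 =>
        have h0 := ih j (by omega)
        have h2 := ih (j + 2) (by omega)
        -- With `B_m = A (f_m - 2)` this reads `B_{j+2} = 2 B_{j+1} - B_{j-1} + f_j`, hence three
        -- base cases.
        have h := A_sub_A_eq (m := (j : ℤ) + 1) (n := f ((j : ℤ) + 2) - 2) (by omega)
          (by have := f_mono (show (j : ℤ) + 1 ≤ j + 2 by omega); omega)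
          (by rw [show (j : ℤ) + 1 + 1 = j + 2 by ring])
        have r1 := f_eq_add (m := (j : ℤ) + 1) (by omega)
        have r2 := f_eq_add (m := (j : ℤ) + 2) (by omega)
        have r3 := f_eq_add (m := (j : ℤ) + 3) (by omega)
        have r4 := f_eq_add (m := (j : ℤ) + 4) (by omega)
        push_cast at h2 ⊢
        ring_nf at h h0 h2 r1 r2 r3 r4 ⊢
        rw [show -2 + f (2 + (j : ℤ)) - f (j : ℤ) = -2 + f (1 + (j : ℤ)) by omega] at h
        simp only [r4, r3, r2, r1] at h h0 h2 ⊢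
        linear_combination 5 * h - h0 + 2 * h2
  have := key (m + 1).toNat
  rw [Int.toNat_of_nonneg (by omega), add_sub_cancel_right,
    show m + 1 + 1 = m + 2 by ring] at this
  exact this

theorem A_f_sub_two {m : ℤ} (hm : -1 ≤ m) : A (f m - 2) = explicitA m := by
  have h := five_mul_A_f_sub_two hm
  rw [explicitA, ← h, Int.mul_ediv_cancel_left _ (by norm_num)]
  ring

theorem C_eq_explicitC {m : ℤ} (hm : -1 ≤ m) : C m = explicitC m := by
  have h1 := five_mul_A_f_sub_two hm
  have h2 := five_mul_A_f_sub_two (m := m + 1) (by omega)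
  have r1 := f_eq_add (m := m + 1) (by omega)
  have r2 := f_eq_add (m := m + 2) (by omega)
  have r3 := f_eq_add (m := m + 3) (by omega)
  have h : (m + 1) * f (m + 1) + (m - 2) * f (m - 1) = 5 * C m := by
    rw [C]
    ring_nf at *
    rw [r3, r2, r1] at *
    linear_combination h1 - h2
  rw [explicitC, h, Int.mul_ediv_cancel_left _ (by norm_num)]

/-! ### The algorithm -/

theorem recSum_fst {m : ℕ} {n : ℤ} (h1 : f m ≤ n + 1) (h2 : n + 1 < f (m + 1)) :
    (recSum m n).1 = A n - A (f m - 2) := by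
  induction m using Nat.strong_induction_on generalizing n with
  | _ m ih =>
    match m with
    | 0 =>
      have e0 : f ((0 : ℕ) : ℤ) = 1 := rfl
      have e1 : f ((0 : ℕ) + 1 : ℤ) = 2 := rfl
      rw [e0] at h1 ⊢
      rw [e1] at h2
      rw [A_of_nonpos (by omega), A_of_nonpos (by omega)]
      rfl
    | 1 =>
      have e0 : f ((1 : ℕ) : ℤ) = 2 := rfl
      have e1 : f ((1 : ℕ) + 1 : ℤ) = 3 := rfl
      rw [e0] at h1 ⊢
      rw [e1] at h2
      obtain rfl : n = 1 := by omega
      have h := A_sub_A_eq (m := 1) (n := 1) le_rfl (by decide) (by decide)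
      rw [f_one] at h
      rw [h, A_of_nonpos (by decide), A_of_nonpos (by decide)]
      rfl
    | m + 2 =>
      push_cast at h1 h2 ⊢
      have h3 := A_sub_A_eq (m := (m : ℤ) + 2) (n := n) (by omega) (by omega) (by omega)
      have r2 := f_eq_add (m := (m : ℤ) + 2) (by omega)
      have r3 := f_eq_add (m := (m : ℤ) + 2 + 1) (by omega)
      rw [show (m : ℤ) + 2 - 1 = m + 1 by ring, add_sub_cancel_right] at *
      rw [show (m : ℤ) + 2 + 1 - 2 = m + 1 by ring] at r3
      rw [recSum]
      -- The test decides whether `n - f_{m+1}` has index `m` or `m + 1`; in the latter case `C m`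
      -- moves the base point back to `f_m - 2`.
      split_ifs with hc
      · have := ih m (by omega) (n := n - f (m + 1)) (by omega) (by omega)
        simp only
        omega
      · have := ih (m + 1) (by omega) (n := n - f (m + 1)) (by push_cast; omega)
          (by push_cast; rw [show (m : ℤ) + 1 + 1 = m + 2 by ring]; omega)
        have hC := C_eq_explicitC (m := m) (by omega)
        rw [C] at hC
        push_cast at this
        simp only
        omega

/-- Each call lowers `m` by at least one and stops at 1. The sharp `m - 1` matters for the
logarithmic bound. -/
theorem recSum_snd_le (m : ℕ) (n : ℤ) : (recSum m n).2 ≤ m - 1 := by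
  induction m using Nat.strong_induction_on generalizing n with
  | _ m ih =>
    match m with
    | 0 => exact le_rfl
    | 1 => exact le_rfl
    | m + 2 =>
      rw [recSum]
      split_ifs
      · have := ih m (by omega) (n - f (m + 1))
        simp only
        omega
      · have := ih (m + 1) (by omega) (n - f (m + 1))
        simp only
        omega

theorem two_pow_le_fib (j : ℕ) : 2 ^ j ≤ Nat.fib (2 * j + 2) := by
  induction j with
  | zero => exact le_rfl
  | succ j ih =>
    have h1 : Nat.fib (2 * j + 4) = Nat.fib (2 * j + 2) + Nat.fib (2 * j + 3) := Nat.fib_add_two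
    have h2 : Nat.fib (2 * j + 2) ≤ Nat.fib (2 * j + 3) := Nat.fib_le_fib_succ
    rw [pow_succ, show 2 * (j + 1) + 2 = 2 * j + 4 by ring]
    omega

theorem findIndex_spec {n : ℕ} :
    f (findIndex n) ≤ (n : ℤ) + 1 ∧ (n : ℤ) + 1 < f (findIndex n + 1) := by
  refine ⟨?_, Nat.find_spec (exists_lt_f n)⟩
  rcases Nat.eq_zero_or_pos (findIndex n) with h | h
  · rw [h, Nat.cast_zero, f_zero]
    omega
  · have h1 := Nat.find_min (exists_lt_f n) (m := findIndex n - 1) (Nat.sub_lt h one_pos)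
    rw [not_lt, Nat.cast_sub (show 1 ≤ findIndex n from h), Nat.cast_one, sub_add_cancel] at h1
    exact h1

theorem index_unique {m k n : ℤ} (h1 : f m ≤ n) (h2 : n < f (m + 1)) (h3 : f k ≤ n)
    (h4 : n < f (k + 1)) : m = k := by
  rcases lt_trichotomy m k with h | h | h
  · have := f_mono (show m + 1 ≤ k by omega)
    omega
  · exact h
  · have := f_mono (show k + 1 ≤ m by omega)
    omega

end FibPal

theorem mainTheorem5 (n : ℕ) (hn : 1 ≤ n) :
    (∃! m : ℤ, FibPal.f m ≤ (n : ℤ) + 1 ∧ (n : ℤ) + 1 < FibPal.f (m + 1)) ∧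
    (∀ m : ℤ, FibPal.f m ≤ (n : ℤ) + 1 → (n : ℤ) + 1 < FibPal.f (m + 1) →
      ((n : ℤ) + 1 < 2 * FibPal.f (m - 1) →
        (∑ i ∈ Finset.Icc (FibPal.f m - 1) (n : ℤ), FibPal.a i) =
          (∑ i ∈ Finset.Icc (FibPal.f (m - 2) - 1) ((n : ℤ) - FibPal.f (m - 1)), FibPal.a i)
            + (n : ℤ) - FibPal.f m + 2) ∧
      (2 * FibPal.f (m - 1) ≤ (n : ℤ) + 1 →
        (∑ i ∈ Finset.Icc (FibPal.f m - 1) (n : ℤ), FibPal.a i) =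
          (∑ i ∈ Finset.Icc (FibPal.f (m - 1) - 1) ((n : ℤ) - FibPal.f (m - 1)), FibPal.a i)
            + FibPal.C (m - 2) + (n : ℤ) - FibPal.f m + 2) ∧
      FibPal.A n = FibPal.A (FibPal.f m - 2)
        + (∑ i ∈ Finset.Icc (FibPal.f m - 1) (n : ℤ), FibPal.a i) ∧
      FibPal.A (FibPal.f m - 2) = FibPal.explicitA m ∧
      FibPal.C (m - 2) = FibPal.explicitC (m - 2) ∧
      ((FibPal.algorithmA n).2 : ℤ) ≤ m) ∧
    (FibPal.algorithmA n).1 = FibPal.A n ∧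
    (FibPal.algorithmA n).2 ≤ 2 * Nat.log 2 (n + 1) := by
  obtain ⟨hm1, hm2⟩ := FibPal.findIndex_spec (n := n)
  -- The recursion fails at `m = 0`, `n = 0`: it would give 1 instead of `a 0 = 0`.
  have hpos : 1 ≤ FibPal.findIndex n := by
    rw [Nat.one_le_iff_ne_zero]
    intro h
    rw [h, Nat.cast_zero, zero_add, FibPal.f_one] at hm2
    omega
  have hcount : (FibPal.algorithmA n).2 ≤ FibPal.findIndex n - 1 :=
    FibPal.recSum_snd_le (FibPal.findIndex n) n
  refine ⟨⟨FibPal.findIndex n, ⟨hm1, hm2⟩, fun k hk => FibPal.index_unique hk.1 hk.2 hm1 hm2⟩,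
    fun m h1 h2 => ?_, ?_, ?_⟩
  · obtain rfl := FibPal.index_unique h1 h2 hm1 hm2
    have hcount' : ((FibPal.algorithmA n).2 : ℤ) ≤ (FibPal.findIndex n : ℤ) := by omega
    have hm : (1 : ℤ) ≤ (FibPal.findIndex n : ℤ) := by omega
    generalize (FibPal.findIndex n : ℤ) = m at h1 h2 hcount' hm ⊢
    have hf := FibPal.f_eq_add (m := m) (by omega)
    have hA := FibPal.A_sub_A_eq (n := n) hm (by omega) (by omega)
    have hsum := FibPal.sum_a_Icc (u := FibPal.f m - 1) (n := n) (by omega)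
    rw [show FibPal.f m - 1 - 1 = FibPal.f m - 2 by ring] at hsum
    rw [hsum]
    refine ⟨fun h => ?_, fun h => ?_, by ring, FibPal.A_f_sub_two (by omega),
      FibPal.C_eq_explicitC (by omega), hcount'⟩
    · rw [FibPal.sum_a_Icc (by omega),
        show FibPal.f (m - 2) - 1 - 1 = FibPal.f (m - 2) - 2 by ring, hA]
      ring
    · rw [FibPal.sum_a_Icc (by omega), FibPal.C, show m - 2 + 1 = m - 1 by ring,
        show FibPal.f (m - 1) - 1 - 1 = FibPal.f (m - 1) - 2 by ring, hA]
      ring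
  · rw [FibPal.algorithmA]
    simp only
    rw [FibPal.recSum_fst hm1 hm2, FibPal.A_f_sub_two (by omega)]
    ring
  -- `2 ^ ⌊m/2⌋ ≤ f_m ≤ n + 1`, while the number of calls is at most `m - 1 ≤ 2 ⌊m/2⌋`.
  · have h3 := FibPal.two_pow_le_fib (FibPal.findIndex n / 2)
    have h4 : Nat.fib (2 * (FibPal.findIndex n / 2) + 2) ≤ Nat.fib (FibPal.findIndex n + 2) :=
      Nat.fib_mono (by omega)
    rw [FibPal.f_natCast] at hm1
    have h5 : FibPal.findIndex n / 2 ≤ Nat.log 2 (n + 1) :=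
      Nat.le_log_of_pow_le one_lt_two (by omega)
    omega
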